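/- Fix a level $\alpha\in(0,1)$. A discrete cost distribution $\mathcal D$ consists of values $a_1<\dots<a_k$ in $[-\alpha,1-\alpha]$, at least one of them $\le 0$ and at least one $>0$, with probabilities $p_i>0$, $\sum_i p_i=1$. For a horizon $T$ let the costs $a^{(1)},\dots,a^{(T)}$ be i.i.d. from $\mathcal D$. Let $f^T_{\mathcal D}(\mathbf{HO_{any}})$ be the expectation of the maximum of $\sum_{t=1}^T X^{(t)}$ over $X\in\{0,1\}^T$ with $\sum_{s\le t}a^{(s)}X^{(s)}\le 0$ for all $t\in[T]$. For an online policy $\pi$ let $f^T_{\mathcal D}(\pi)$ be its expected number of accepted arrivals. The budget is $B^{(1)}=0$, $B^{(t+1)}=B^{(t)}-a^{(t)}\mathbf 1\{a^{(t)}\text{ accepted}\}$. For $b\ge 0$ let $x(b)$ be an optimal solution of the linear program (DLP): maximize $\sum_i p_ix_i$ subject to $\sum_i a_ip_ix_i\le b$ and $0\le x_i\le 1$ for all $i$. A re-solving heuristic has a set of re-solving periods containing period $1$. If $\tau\le t$ is the last re-solving period up to $t$, and the arrival of period $t$ has type $i$, then the arrival is accepted with probability $g(x_i)$, where $x=x\big(B^{(\tau)}/(T-\tau+1)\big)$,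 provided that the current budget covers the cost; otherwise it is rejected. "Covers" may be read either as $a_i\le B^{(t)}$ or as $a_i<B^{(t)}$, with the same reading throughout. The heuristics are: - $\mathbf{FR}$: re-solve in every period, $g(y)=y$; - $\mathbf{IFR}$: re-solve in an arbitrary set of periods containing period $1$; $g$ truncates probabilities, i.e. $g(0)=0$, $g(1)=1$, and for some thresholds $0\le \ell\le h\le 1$ it maps $y<\ell$ to $0$, $y>h$ to $1$, leaves $y\in(\ell,h)$ unchanged, and maps a threshold $y$ itself to $0$, $y$ or $1$; $g$ may depend on the re-solving period and on the type; - $\mathbf{FRT}$: as $\mathbf{IFR}$ with the same truncation rule, but re-solve in every period; - $\mathbf{Bayes}$ (Bayes Selector): re-solve in every period, $g(y)=\mathbf 1\{y\ge 1/2\}$. For every $\alpha\in(0,1)$ the following hold. 1. There is a distribution $\mathcal D$ such that (a) the DLP with $b=0$ is degenerate, i.e. $\sum_{j\le i}p_ja_j=0$ for some $i$ with $a_i>0$; (b) for every $T$, all re-solving sets and truncation rules, every choice of optimal solutions $x(\cdot)$ and either reading of "covers", each of $\mathbf{FR},\mathbf{IFR},\mathbf{FRT},\mathbf{Bayes}$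 takes, on every history with nonnegative budgets, the same decisions as the greedy policy, which accepts whenever the budget covers the cost; and (c) $$f_{\mathcal D}^T(\mathbf{HO_{any}})-\max\{f_{\mathcal D}^T(\mathbf{FR}),f_{\mathcal D}^T(\mathbf{IFR}),f_{\mathcal D}^T(\mathbf{FRT}),f_{\mathcal D}^T(\mathbf{Bayes})\}=\Omega(\sqrt T),$$ that is, there are $c>0$ and $T_0$ such that for all $T\ge T_0$ the left side is at least $c\sqrt T$, with $c$ and $T_0$ independent of the re-solving set, the truncation rule, the choice of optimal solutions and the reading of "covers". 2. There is a distribution $\mathcal D$ such that $f_{\mathcal D}^T(\mathbf{HO_{any}})-f_{\mathcal D}^T(\mathbf{Bayes})=\Omega(T)$: there are $c>0$ and $T_0$ such that for all $T\ge T_0$ the left side is at least $cT$, with $c$ and $T_0$ independent of the choice of optimal solutions and of the reading of "covers". -/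

import Mathlib

noncomputable section

/-- A discrete finite cost distribution for the level `α`: the cost takes the values
`a 0 < a 1 < ⋯ < a (k - 1)` in `[-α, 1 - α]`, at least one of them `≤ 0` and at least one `> 0`,
and takes the value `a i` with probability `p i > 0`. -/
structure CostDist (α : ℝ) where
  k : ℕ
  a : Fin k → ℝ
  p : Fin k → ℝ
  a_strictMono : StrictMono a
  a_mem : ∀ i, a i ∈ Set.Icc (-α) (1 - α)
  exists_nonpos : ∃ i, a i ≤ 0
  exists_pos : ∃ i, 0 < a i
  p_pos : ∀ i, 0 < p i
  p_sum : ∑ i, p i = 1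

namespace CostDist

variable {α : ℝ}

/-- The cumulative expected cost `Δ i = ∑_{j ≤ i} p j * a j`. -/
def cumCost (D : CostDist α) (i : Fin D.k) : ℝ :=
  ∑ j ∈ Finset.univ.filter (fun j => j ≤ i), D.p j * D.a j

/-- The deterministic linear program (with zero budget) is degenerate: the cumulative expected
cost vanishes at some type of positive cost. Its optimal solution then accepts exactly the types
up to that one: every variable sits at a bound and the budget constraint is tight. -/
def Degenerate (D : CostDist α) : Prop :=
  ∃ i, 0 < D.a i ∧ D.cumCost i = 0

/-- Feasible set of the deterministic linear program with budget `b` per period. -/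
def dlpFeasible (D : CostDist α) (b : ℝ) : Set (Fin D.k → ℝ) :=
  {x | (∀ i, 0 ≤ x i ∧ x i ≤ 1) ∧ ∑ i, D.a i * D.p i * x i ≤ b}

/-- `x` is an optimal solution of the deterministic linear program with budget `b` per period. -/
def IsDLPSolution (D : CostDist α) (b : ℝ) (x : Fin D.k → ℝ) : Prop :=
  x ∈ D.dlpFeasible b ∧ IsMaxOn (fun y => ∑ i, D.p i * y i) (D.dlpFeasible b) x

/-- `x` picks an optimal solution `x b` for every nonnegative budget `b` per period
(ties between optimal solutions are broken arbitrarily). -/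
def IsDLPSolver (D : CostDist α) (x : ℝ → Fin D.k → ℝ) : Prop :=
  ∀ b, 0 ≤ b → D.IsDLPSolution b (x b)

end CostDist

open Classical in
/-- Hindsight optimum with the any-time constraint on a path of costs `c`: the largest number of
accepted arrivals among all acceptance sets whose accumulated cost is `≤ 0` at every time. -/
def hoAny {T : ℕ} (c : Fin T → ℝ) : ℕ :=
  (Finset.univ.filter (fun S : Finset (Fin T) =>
    ∀ t, ∑ s ∈ S.filter (fun s => s ≤ t), c s ≤ 0)).sup Finset.card

namespace CostDist

variable {α : ℝ}

/-- Expected hindsight optimum for `T` i.i.d. arrivals. Period `t` in the usual numbering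
`1, …, T` is the element `t - 1` of `Fin T`; `ω t` is the type of the arrival in period `t`. -/
def expHOany (D : CostDist α) (T : ℕ) : ℝ :=
  ∑ ω : Fin T → Fin D.k, (∏ t, D.p (ω t)) * (hoAny (fun t => D.a (ω t)) : ℝ)

/-- The budget available at the start of period `t`, when the arrivals are `ω` and the decisions
are `X` (`X s = true` means that the arrival of period `s` is accepted). The initial budget
is zero. -/
def budget (D : CostDist α) {T : ℕ} (ω : Fin T → Fin D.k) (X : Fin T → Bool) (t : Fin T) : ℝ :=
  -∑ s ∈ Finset.univ.filter (fun s => s < t), if X s = true then D.a (ω s) else 0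

/-- A randomized policy: `π t ω X` is the probability of accepting the arrival `ω t` of period `t`
after the arrivals `ω s` and the decisions `X s` of the earlier periods `s < t`. All policies below
look at `ω` only up to `t` and at `X` only before `t`. -/
abbrev Policy (D : CostDist α) (T : ℕ) : Type :=
  Fin T → (Fin T → Fin D.k) → (Fin T → Bool) → ℝ

/-- Expected number of accepted arrivals under a policy: the sum over all arrival paths `ω` and
decision paths `X` of their joint probability times the number of acceptances. -/
def expReward (D : CostDist α) {T : ℕ} (π : D.Policy T) : ℝ :=
  ∑ ω : Fin T → Fin D.k, ∑ X : Fin T → Bool,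
    (∏ t, D.p (ω t) * (if X t = true then π t ω X else 1 - π t ω X)) *
      ((Finset.univ.filter (fun t => X t = true)).card : ℝ)

end CostDist

/-- The budget test: the budget `B` covers the cost `c`, in the strict form `c < B` or in the
non-strict form `c ≤ B`. -/
def Covers (strict : Bool) (c B : ℝ) : Prop :=
  if strict = true then c < B else c ≤ B

/-- The last re-solving period not later than `t`, for the set `R` of re-solving periods. -/
def lastResolve {T : ℕ} (R : Finset (Fin T)) (t : Fin T) : Fin T :=
  if h : (R.filter (fun s => s ≤ t)).Nonempty then (R.filter (fun s => s ≤ t)).max' h else t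

/-- `g` truncates probabilities: below a threshold `lo` to `0`, above a threshold `hi` to `1`, and
it changes nothing in between (at the thresholds themselves either convention is allowed). -/
def IsTruncation (g : ℝ → ℝ) : Prop :=
  g 0 = 0 ∧ g 1 = 1 ∧ ∃ lo hi : ℝ, 0 ≤ lo ∧ lo ≤ hi ∧ hi ≤ 1 ∧
    ∀ y, 0 ≤ y → y ≤ 1 →
      (g y = 0 ∨ g y = y ∨ g y = 1) ∧ (y < lo → g y = 0) ∧ (lo < y → y < hi → g y = y) ∧
        (hi < y → g y = 1)

namespace CostDist

variable {α : ℝ}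

open Classical in
/-- The greedy policy: accept whenever the budget covers the cost. -/
def greedy (D : CostDist α) (T : ℕ) (strict : Bool) : D.Policy T := fun t ω X =>
  if Covers strict (D.a (ω t)) (D.budget ω X t) then 1 else 0

open Classical in
/-- The re-solving framework. In period `t`, let `s` be the last re-solving period; the linear
program was solved in period `s` with the budget of that period divided by the number `T - s` of
periods from `s` on (`s` counts from `0`), with solution `x`. An arrival of type `i` whose cost is
covered by the current budget is accepted with probability `g s i (x i)`. -/
def resolve (D : CostDist α) (T : ℕ) (strict : Bool) (R : Finset (Fin T))
    (g : Fin T → Fin D.k → ℝ → ℝ) (x : ℝ → Fin D.k → ℝ) : D.Policy T := fun t ω X =>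
  if Covers strict (D.a (ω t)) (D.budget ω X t) then
    g (lastResolve R t) (ω t)
      (x (D.budget ω X (lastResolve R t) / ((T : ℝ) - ((lastResolve R t : ℕ) : ℝ))) (ω t))
  else 0

/-- Frequent Resolving: re-solve in every period and accept with probability `x i`. -/
def FR (D : CostDist α) (T : ℕ) (strict : Bool) (x : ℝ → Fin D.k → ℝ) : D.Policy T :=
  D.resolve T strict Finset.univ (fun _ _ y => y) x

/-- Infrequent Resolving: re-solve in the periods of `R` and accept with the truncated
probability. The truncation rule `g` may depend on the re-solving period and on the type. -/
def IFR (D : CostDist α) (T : ℕ) (strict : Bool) (R : Finset (Fin T))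
    (g : Fin T → Fin D.k → ℝ → ℝ) (x : ℝ → Fin D.k → ℝ) : D.Policy T :=
  D.resolve T strict R g x

/-- Frequent Resolving with Thresholding: as Infrequent Resolving, but re-solve in every period. -/
def FRT (D : CostDist α) (T : ℕ) (strict : Bool)
    (g : Fin T → Fin D.k → ℝ → ℝ) (x : ℝ → Fin D.k → ℝ) : D.Policy T :=
  D.resolve T strict Finset.univ g x

open Classical in
/-- Bayes Selector: re-solve in every period and accept if and only if `x i ≥ 1 / 2`. -/
def Bayes (D : CostDist α) (T : ℕ) (strict : Bool) (x : ℝ → Fin D.k → ℝ) : D.Policy T :=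
  D.resolve T strict Finset.univ (fun _ _ y => if 1 / 2 ≤ y then 1 else 0) x

/-- The policy takes the same decisions as the greedy policy on every history along which the
budget has never been negative (no other history can occur). -/
def ReducesToGreedy (D : CostDist α) {T : ℕ} (strict : Bool) (π : D.Policy T) : Prop :=
  ∀ t ω X, (∀ s, s ≤ t → 0 ≤ D.budget ω X s) → π t ω X = D.greedy T strict t ω X

end CostDist

end

/-! Both instances use the costs `-1, 1, 2`, scaled by `α (1 - α) / 2` to fit `[-α, 1 - α]`. The
linear program then makes every heuristic concerned greedy: with mean zero its only solution is to
accept everything, and with slightly positive mean every optimal probability is still at least `1 /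
2`, which Bayes rounds up to one. Greedy errs on the pattern `-1, -1, 2, 1, 1` read from its lowest
recurrent budget. It spends its savings on the `2` and must reject both `1`s; rejecting the `2` and
taking both `1`s gains one acceptance and ends with the same budget, so the gains of successive
patterns add up (`achievable_run`). The regret is therefore at least the expected number of patterns
(`expState_n_le`). Every visit to a low budget leads to a pattern with probability bounded below
(`expState_n_add_six`), so low visits have to be counted. Budget drift can be positive only at low
budgets. With mean zero the visits bound the expected budget, which is of order `√T`
(`critical_first_moment_ge`). With positive mean the visits must offset a constant negative drift,
so they are linear in `T` (`supercritical_first_moment`). -/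

noncomputable section

/-! ### Greedy on integer costs and its wasteful pattern. -/

/-- State of the greedy policy on a path of integer costs: the budget `b`, the progress `ph` in the
pattern `-1, -1, 2, 1, 1` read from the lowest recurrent budget, the number `g` of accepted
arrivals, and the number `n` of completed patterns. -/
structure GreedyState where
  b : ℤ
  ph : ℕ
  g : ℕ
  n : ℕ

namespace GreedyState

/-- One arrival of cost `c`, which is accepted when `c + δ ≤ b`. -/
def step (δ : ℤ) (s : GreedyState) (c : ℤ) : GreedyState where
  b := if c + δ ≤ s.b then s.b - c else s.b
  -- The budget is tested first: at progress 3 or 4 the budget is again `δ`, so a `-1` there starts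
  -- a new pattern at once.
  ph := if s.b = δ ∧ c = -1 then 1 else if s.ph = 1 ∧ c = -1 then 2 else
    if s.ph = 2 ∧ c = 2 then 3 else if s.ph = 3 ∧ c = 1 then 4 else 0
  g := if c + δ ≤ s.b then s.g + 1 else s.g
  n := if s.ph = 4 ∧ c = 1 then s.n + 1 else s.n

/-- The state after a path of costs. -/
def run (δ : ℤ) : {T : ℕ} → (Fin T → ℤ) → GreedyState
  | 0, _ => ⟨0, 0, 0, 0⟩
  | _ + 1, c => (run δ (Fin.init c)).step δ (c (Fin.last _))

/-- In the course of a pattern the budget is determined by the progress. -/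
structure Valid (δ : ℤ) (s : GreedyState) : Prop where
  nonneg : 0 ≤ s.b
  one : s.ph = 1 → s.b = δ + 1
  two : s.ph = 2 → s.b = δ + 2
  three : s.ph = 3 → s.b = δ
  four : s.ph = 4 → s.b = δ

lemma Valid.step {δ : ℤ} (hδ : 0 ≤ δ) {s : GreedyState} (h : s.Valid δ) (c : ℤ) :
    (s.step δ c).Valid δ := by
  obtain ⟨h0, h1, h2, h3, h4⟩ := h
  constructor <;> simp only [GreedyState.step] <;> grind

lemma valid_run {δ : ℤ} (hδ : 0 ≤ δ) : ∀ {T : ℕ} (c : Fin T → ℤ), (run δ c).Valid δ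
  | 0, _ => by constructor <;> simp [run]
  | _ + 1, c => (valid_run hδ (Fin.init c)).step hδ _

end GreedyState

/-! ### Hindsight decisions that beat greedy by one per pattern. -/

/-- Some decisions that respect the budget at all times accept `m` arrivals and end with
budget `b`. -/
def Achievable {T : ℕ} (c : Fin T → ℝ) (m : ℕ) (b : ℝ) : Prop :=
  0 ≤ b ∧ ∃ X : Fin T → Bool, (∀ t, ∑ s, (if s ≤ t ∧ X s = true then c s else 0) ≤ 0) ∧
    (∑ s, if X s = true then 1 else 0) = m ∧ b = -∑ s, if X s = true then c s else 0

lemma Achievable.reject {T : ℕ} {c : Fin (T + 1) → ℝ} {m : ℕ} {b : ℝ}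
    (h : Achievable (Fin.init c) m b) : Achievable c m b := by
  obtain ⟨hb, X, hX, hm, hs⟩ := h
  simp only [Fin.init] at hX hs
  refine ⟨hb, Fin.snoc X false, fun t => ?_, ?_, ?_⟩
  · induction t using Fin.lastCases with
    | last =>
      simp only [Fin.sum_univ_castSucc, Fin.snoc_castSucc, Fin.snoc_last, Fin.le_last]
      simp only [true_and, Bool.false_eq_true, and_false, if_false]
      linarith
    | cast t =>
      simpa only [Fin.sum_univ_castSucc, Fin.snoc_castSucc, Fin.snoc_last, Bool.false_eq_true,
        and_false, if_false, add_zero, Fin.castSucc_le_castSucc_iff] using hX t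
  · simpa only [Fin.sum_univ_castSucc, Fin.snoc_castSucc, Fin.snoc_last, Bool.false_eq_true,
      if_false, add_zero] using hm
  · simpa only [Fin.sum_univ_castSucc, Fin.snoc_castSucc, Fin.snoc_last, Bool.false_eq_true,
      if_false, add_zero] using hs

lemma Achievable.accept {T : ℕ} {c : Fin (T + 1) → ℝ} {m : ℕ} {b b' : ℝ}
    (h : Achievable (Fin.init c) m b) (hb' : b' = b - c (Fin.last T)) (h0 : 0 ≤ b') :
    Achievable c (m + 1) b' := by
  obtain ⟨hb, X, hX, hm, hs⟩ := h
  simp only [Fin.init] at hX hs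
  refine ⟨h0, Fin.snoc X true, fun t => ?_, ?_, ?_⟩
  · induction t using Fin.lastCases with
    | last =>
      simp only [Fin.sum_univ_castSucc, Fin.snoc_castSucc, Fin.snoc_last, Fin.le_last]
      simp only [true_and, if_true]
      linarith
    | cast t =>
      have : ¬ Fin.last T ≤ t.castSucc := not_le.2 (Fin.castSucc_lt_last t)
      simpa only [Fin.sum_univ_castSucc, Fin.snoc_castSucc, Fin.snoc_last, this,
        false_and, if_false, add_zero, Fin.castSucc_le_castSucc_iff] using hX t
  · simp only [Fin.sum_univ_castSucc, Fin.snoc_castSucc, Fin.snoc_last, if_true, hm]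
  · simp only [Fin.sum_univ_castSucc, Fin.snoc_castSucc, Fin.snoc_last, if_true]
    linarith

lemma Achievable.le_hoAny {T : ℕ} {c : Fin T → ℝ} {m : ℕ} {b : ℝ} (h : Achievable c m b) :
    m ≤ hoAny c := by
  classical
  obtain ⟨-, X, hX, hm, -⟩ := h
  have hcard : (Finset.univ.filter fun s => X s = true).card = m := by
    rw [Finset.card_filter, hm]
  rw [← hcard]
  refine Finset.le_sup (f := Finset.card) (Finset.mem_filter.2 ⟨Finset.mem_univ _, fun t => ?_⟩)
  refine le_of_eq_of_le ?_ (hX t)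
  rw [Finset.filter_filter, Finset.sum_filter]
  refine Finset.sum_congr rfl fun s _ => ?_
  simp only [and_comm]

open GreedyState in
/-- Rejecting the `2` of a pattern allows the acceptance of both its final `1`s, so decisions that
respect the budget can accept one more arrival per pattern than greedy. -/
lemma achievable_run {ε : ℝ} (hε : 0 < ε) {δ : ℤ} (hδ : 0 ≤ δ) : ∀ {T : ℕ} (c : Fin T → ℤ),
    Achievable (fun t => ε * c t) ((run δ c).g + (run δ c).n) (ε * (run δ c).b) ∧
    ((run δ c).ph = 3 → ∃ m, m + 1 = (run δ c).g + (run δ c).n ∧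
      Achievable (fun t => ε * c t) m (ε * ((run δ c).b + 2))) ∧
    ((run δ c).ph = 4 →
      Achievable (fun t => ε * c t) ((run δ c).g + (run δ c).n) (ε * ((run δ c).b + 1)))
  | 0, _ => by
    refine ⟨⟨?_, Fin.elim0, fun t => t.elim0, ?_, ?_⟩, ?_, ?_⟩ <;> simp [run]
  | T + 1, c => by
    obtain ⟨h, h3, h4⟩ := achievable_run hε hδ (Fin.init c)
    have hv := valid_run hδ (Fin.init c)
    have hinit : (fun t => ε * (Fin.init c t : ℝ)) = Fin.init fun t => ε * (c t : ℝ) := rfl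
    rw [hinit] at h h3 h4
    simp only [run]
    set s := run δ (Fin.init c)
    set x := c (Fin.last T) with hx
    have acc : ∀ {m : ℕ} {b : ℤ} {b' : ℝ},
        Achievable (Fin.init fun t => ε * (c t : ℝ)) m (ε * b) → x ≤ b → b' = ε * (b - x : ℤ) →
        Achievable (fun t => ε * (c t : ℝ)) (m + 1) b' := by
      intro m b b' hA hxb hb'
      refine hA.accept (by rw [hb', hx]; push_cast; ring) ?_
      rw [hb']
      exact mul_nonneg hε.le (by exact_mod_cast sub_nonneg.2 hxb)
    refine ⟨?_, fun hp => ?_, fun hp => ?_⟩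
    -- On completing a pattern, greedy rejects the last `1`, while the alternative accepts it from a
    -- budget one higher; the two budgets then coincide again.
    · by_cases hn : s.ph = 4 ∧ x = 1
      · have hb := hv.four hn.1
        have hna : ¬ x + δ ≤ s.b := by omega
        have e : (s.step δ x).g + (s.step δ x).n = s.g + s.n + 1 := by
          simp only [step, if_neg hna, if_pos hn, add_assoc]
        have e' : (s.step δ x).b = s.b := by simp only [step, if_neg hna]
        rw [e, e']
        have := h4 hn.1
        refine acc (b := s.b + 1) (by exact_mod_cast this) (by omega) ?_
        rw [hn.2]; push_cast; ring
      · have en : (s.step δ x).n = s.n := by simp only [step]; rw [if_neg hn]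
        by_cases ha : x + δ ≤ s.b
        · have e : (s.step δ x).g = s.g + 1 := by simp [step, ha]
          have e' : (s.step δ x).b = s.b - x := by simp [step, ha]
          rw [en, e, e', add_right_comm]
          exact acc h (by omega) rfl
        · have e : (s.step δ x).g = s.g := by simp [step, ha]
          have e' : (s.step δ x).b = s.b := by simp [step, ha]
          rw [en, e, e']
          exact h.reject
    -- The alternative rejects the `2` that greedy accepts: one acceptance behind, two units of
    -- budget ahead.
    · have hph : s.ph = 2 ∧ x = 2 := by
        simp only [step] at hp
        grind
      have hb := hv.two hph.1
      have ha : x + δ ≤ s.b := by omega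
      have hn4 : ¬ (s.ph = 4 ∧ x = 1) := by omega
      have e : (s.step δ x).g + (s.step δ x).n = s.g + s.n + 1 := by
        simp only [step, if_pos ha, if_neg hn4, add_right_comm]
      have e' : (s.step δ x).b = s.b - 2 := by
        simp only [step, if_pos ha]; rw [hph.2]
      refine ⟨s.g + s.n, e.symm, ?_⟩
      rw [e']
      have := h.reject
      convert this using 2
      push_cast; ring
    -- The alternative takes the first `1`, which greedy cannot afford: the counts are level and one
    -- unit of budget is left over.
    · have hph : s.ph = 3 ∧ x = 1 := by
        simp only [step] at hp
        grind
      have hb := hv.three hph.1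
      have hna : ¬ x + δ ≤ s.b := by omega
      have hn4 : ¬ (s.ph = 4 ∧ x = 1) := by omega
      have e : (s.step δ x).g + (s.step δ x).n = s.g + s.n := by
        simp only [step, if_neg hna, if_neg hn4]
      have e' : (s.step δ x).b = s.b := by simp only [step, if_neg hna]
      obtain ⟨m, hm, hA⟩ := h3 hph.1
      rw [e, e', ← hm]
      refine acc (b := s.b + 2) (by exact_mod_cast hA) (by omega) ?_
      rw [hph.2]; push_cast; ring

/-! ### Regret as an expectation over the greedy chain. -/

namespace CostDist

variable {α : ℝ}

lemma budget_castSucc (D : CostDist α) {T : ℕ} (ω : Fin (T + 1) → Fin D.k)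
    (X : Fin (T + 1) → Bool) (t : Fin T) :
    D.budget ω X t.castSucc = D.budget (Fin.init ω) (Fin.init X) t := by
  have : ¬ Fin.last T < t.castSucc := not_lt.2 (Fin.castSucc_lt_last t).le
  simp [budget, Finset.sum_filter, Fin.sum_univ_castSucc, this, Fin.init]
  rfl

lemma budget_last (D : CostDist α) {T : ℕ} (ω : Fin (T + 1) → Fin D.k)
    (X : Fin (T + 1) → Bool) :
    D.budget ω X (Fin.last T) =
      -∑ s, if Fin.init X s = true then D.a (Fin.init ω s) else 0 := by
  simp [budget, Finset.sum_filter, Fin.sum_univ_castSucc, Fin.init, Fin.castSucc_lt_last]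
  rfl

/-- The shift of the budget test for costs in `ε ℤ`. -/
def shift (strict : Bool) : ℤ := if strict = true then 1 else 0

lemma shift_nonneg (strict : Bool) : 0 ≤ shift strict := by cases strict <;> simp [shift]

lemma shift_le_one (strict : Bool) : shift strict ≤ 1 := by cases strict <;> simp [shift]

/-- On multiples of `ε` a strict inequality is a non-strict one with a margin of one unit, so a
single parameter handles both readings of the budget test. -/
lemma covers_iff {ε : ℝ} (hε : 0 < ε) (strict : Bool) (c b : ℤ) :
    Covers strict (ε * c) (ε * b) ↔ c + shift strict ≤ b := by
  cases strict
  · simp [Covers, shift, hε]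
  · simp only [Covers, shift, if_true, mul_lt_mul_iff_right₀ hε, Int.cast_lt]
    omega

/-- On every path of arrivals there are greedy decisions, and `GreedyState.run` tracks them. -/
lemma exists_greedy (D : CostDist α) {ε : ℝ} (hε : 0 < ε) {v : Fin D.k → ℤ}
    (hv : ∀ i, D.a i = ε * v i) (strict : Bool) : ∀ {T : ℕ} (ω : Fin T → Fin D.k),
    ∃ X : Fin T → Bool, (∀ t, X t = true ↔ Covers strict (D.a (ω t)) (D.budget ω X t)) ∧
      (∀ t, 0 ≤ D.budget ω X t) ∧
      (∑ s, if X s = true then 1 else 0) =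
        (GreedyState.run (shift strict) fun t => v (ω t)).g ∧
      -(∑ s, if X s = true then D.a (ω s) else 0) =
        ε * (GreedyState.run (shift strict) fun t => v (ω t)).b
  | 0, _ => ⟨Fin.elim0, fun t => t.elim0, fun t => t.elim0, by simp [GreedyState.run],
      by simp [GreedyState.run]⟩
  | T + 1, ω => by
    classical
    obtain ⟨X, hX, h0, hg, hb⟩ := exists_greedy D hε hv strict (Fin.init ω)
    have hinit : (Fin.init fun t => v (ω t)) = fun t => v (Fin.init ω t) := rfl
    have hval := GreedyState.valid_run (shift_nonneg strict) fun t => v (Fin.init ω t)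
    simp only [GreedyState.run, hinit]
    set s := GreedyState.run (shift strict) fun t => v (Fin.init ω t)
    have hlast : ∀ d : Bool, D.budget ω (Fin.snoc (α := fun _ => Bool) X d) (Fin.last T) =
        ε * s.b := by
      intro d; rw [budget_last, Fin.init_snoc, hb]
    have hcast : ∀ (d : Bool) (t : Fin T),
        D.budget ω (Fin.snoc (α := fun _ => Bool) X d) t.castSucc =
          D.budget (Fin.init ω) X t := by
      intro d t; rw [budget_castSucc, Fin.init_snoc]
    refine ⟨Fin.snoc X (decide (v (ω (Fin.last T)) + shift strict ≤ s.b)), fun t => ?_,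
      fun t => ?_, ?_, ?_⟩
    · induction t using Fin.lastCases with
      | last => rw [hlast, hv, covers_iff hε, Fin.snoc_last, decide_eq_true_iff]
      | cast t => rw [hcast, Fin.snoc_castSucc]; exact hX t
    · induction t using Fin.lastCases with
      | last => rw [hlast]; exact mul_nonneg hε.le (by exact_mod_cast hval.nonneg)
      | cast t => rw [hcast]; exact h0 t
    · simp only [Fin.sum_univ_castSucc, Fin.snoc_castSucc, Fin.snoc_last, hg, GreedyState.step,
        decide_eq_true_iff]
      split_ifs <;> rfl
    · have hb' : -(∑ s, if X s = true then D.a (ω s.castSucc) else 0) = ε * s.b := hb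
      simp only [Fin.sum_univ_castSucc, Fin.snoc_castSucc, Fin.snoc_last, GreedyState.step,
        decide_eq_true_iff, neg_add, hb', hv (ω (Fin.last T))]
      split_ifs
      · push_cast; ring
      · simp

/-- The expected value of a function of the greedy state after `T` arrivals. -/
def expState {k : ℕ} (p : Fin k → ℝ) (v : Fin k → ℤ) (δ : ℤ) (T : ℕ) (F : GreedyState → ℝ) : ℝ :=
  ∑ ω : Fin T → Fin k, (∏ t, p (ω t)) * F (GreedyState.run δ fun t => v (ω t))

/-- For fixed arrivals only the greedy decision path has nonzero probability. Its budgets are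
nonnegative, so the policy agrees with greedy along it. -/
lemma expReward_eq (D : CostDist α) {ε : ℝ} (hε : 0 < ε) {v : Fin D.k → ℤ}
    (hv : ∀ i, D.a i = ε * v i) {strict : Bool} {T : ℕ} {π : D.Policy T}
    (hπ : D.ReducesToGreedy strict π) :
    D.expReward π = expState D.p v (shift strict) T fun s => (s.g : ℝ) := by
  classical
  refine Finset.sum_congr rfl fun ω _ => ?_
  obtain ⟨X, hX, h0, hg, -⟩ := D.exists_greedy hε hv strict ω
  rw [Finset.sum_eq_single X]
  · congr 1
    · refine Finset.prod_congr rfl fun t _ => ?_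
      rw [hπ t ω X fun s _ => h0 s, greedy]
      by_cases h : X t = true
      · simp [h, (hX t).1 h]
      · simp [h, mt (hX t).2 h]
    · rw [Finset.card_filter]
      exact congrArg Nat.cast hg
  · intro Y _ hY
    obtain ⟨u, hu⟩ := Function.ne_iff.1 hY
    -- At the first deviation the budgets still agree with those of the greedy path, so the
    -- deviating decision has probability zero and kills the product.
    obtain ⟨t, ht, hmin⟩ := (Finset.univ.filter fun t => Y t ≠ X t).exists_minimal
      ⟨u, by simpa using hu⟩
    simp only [Finset.mem_filter, Finset.mem_univ, true_and] at ht hmin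
    have hlt : ∀ s, s < t → Y s = X s := by
      intro s hs
      by_contra hne
      exact absurd (hmin hne hs.le) (not_le.2 hs)
    have hbud : ∀ s, s ≤ t → D.budget ω Y s = D.budget ω X s := by
      intro s hs
      refine congrArg Neg.neg (Finset.sum_congr rfl fun r hr => ?_)
      rw [hlt r ((Finset.mem_filter.1 hr).2.trans_le hs)]
    rw [Finset.prod_eq_zero (Finset.mem_univ t), zero_mul]
    rw [hπ t ω Y fun s hs => (hbud s hs).symm ▸ h0 s, greedy, hbud t le_rfl]
    by_cases h : X t = true
    · have hY : ¬ Y t = true := fun h' => ht (h'.trans h.symm)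
      simp [hY, (hX t).1 h]
    · have hY : Y t = true := by
        by_contra h'
        exact ht (by rw [Bool.not_eq_true] at h h'; rw [h, h'])
      simp [hY, mt (hX t).2 h]
  · simp

section Expectation

variable {k : ℕ} {p : Fin k → ℝ} {v : Fin k → ℤ} {δ : ℤ}

lemma expState_zero (F : GreedyState → ℝ) : expState p v δ 0 F = F ⟨0, 0, 0, 0⟩ := by
  simp [expState, GreedyState.run]

/-- The Markov property: average over the last arrival first. Every later expectation bound becomes
a one-step inequality through this identity. -/
lemma expState_succ (T : ℕ) (F : GreedyState → ℝ) :
    expState p v δ (T + 1) F = expState p v δ T fun s => ∑ i, p i * F (s.step δ (v i)) := by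
  unfold expState
  rw [← (Fin.snocEquiv fun _ : Fin (T + 1) => Fin k).sum_comp, Fintype.sum_prod_type,
    Finset.sum_comm]
  refine Finset.sum_congr rfl fun ω _ => ?_
  rw [Finset.mul_sum]
  refine Finset.sum_congr rfl fun i _ => ?_
  have : (Fin.init fun t => v (Fin.snoc (α := fun _ => Fin k) ω i t)) = fun t => v (ω t) := by
    funext t; simp [Fin.init]
  simp only [Fin.snocEquiv, Equiv.coe_fn_mk, Fin.prod_univ_castSucc, Fin.snoc_castSucc,
    Fin.snoc_last, GreedyState.run, this, mul_assoc]

lemma expState_mono (hp : ∀ i, 0 ≤ p i) (hδ : 0 ≤ δ) (T : ℕ) {F G : GreedyState → ℝ}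
    (h : ∀ s, s.Valid δ → F s ≤ G s) : expState p v δ T F ≤ expState p v δ T G :=
  Finset.sum_le_sum fun _ _ => mul_le_mul_of_nonneg_left (h _ (GreedyState.valid_run hδ _))
    (Finset.prod_nonneg fun _ _ => hp _)

lemma expState_add (T : ℕ) (F G : GreedyState → ℝ) :
    expState p v δ T (fun s => F s + G s) = expState p v δ T F + expState p v δ T G := by
  simp only [expState, mul_add, Finset.sum_add_distrib]

lemma expState_mul (T : ℕ) (a : ℝ) (F : GreedyState → ℝ) :
    expState p v δ T (fun s => a * F s) = a * expState p v δ T F := by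
  simp only [expState, Finset.mul_sum]
  exact Finset.sum_congr rfl fun _ _ => by ring

lemma expState_const (hp : ∑ i, p i = 1) (a : ℝ) (T : ℕ) :
    expState p v δ T (fun _ => a) = a := by
  induction T with
  | zero => rw [expState_zero]
  | succ T ih => rw [expState_succ, ← Finset.sum_mul, hp, one_mul, ih]

end Expectation

lemma expState_le_expHOany (D : CostDist α) {ε : ℝ} (hε : 0 < ε) {v : Fin D.k → ℤ}
    (hv : ∀ i, D.a i = ε * v i) {δ : ℤ} (hδ : 0 ≤ δ) (T : ℕ) :
    expState D.p v δ T (fun s => (s.g : ℝ) + s.n) ≤ D.expHOany T := by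
  refine Finset.sum_le_sum fun ω _ => mul_le_mul_of_nonneg_left ?_
    (Finset.prod_nonneg fun _ _ => (D.p_pos _).le)
  have := (achievable_run hε hδ fun t => v (ω t)).1.le_hoAny
  simp only [hv]
  exact_mod_cast this

/-- Greedy is worse than the hindsight optimum by the expected number of patterns. -/
lemma expState_n_le (D : CostDist α) {ε : ℝ} (hε : 0 < ε) {v : Fin D.k → ℤ}
    (hv : ∀ i, D.a i = ε * v i) {strict : Bool} {T : ℕ} {π : D.Policy T}
    (hπ : D.ReducesToGreedy strict π) :
    expState D.p v (shift strict) T (fun s => (s.n : ℝ)) ≤ D.expHOany T - D.expReward π := by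
  have := D.expState_le_expHOany hε hv (shift_nonneg strict) T
  rw [expState_add] at this
  rw [D.expReward_eq hε hv hπ]
  linarith

end CostDist

/-! ### From low budgets to completed patterns. -/

namespace CostDist

variable {α : ℝ}

section Patterns

variable {k : ℕ} {p : Fin k → ℝ} {v : Fin k → ℤ} {δ : ℤ} {m : ℝ}

/-- The probability of a property of the greedy state after `T` arrivals. -/
def probState (p : Fin k → ℝ) (v : Fin k → ℤ) (δ : ℤ) (T : ℕ) (P : GreedyState → Prop)
    [DecidablePred P] : ℝ :=
  expState p v δ T fun s => if P s then 1 else 0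

/-- A single favourable arrival suffices, and each arrival type has probability at least `m`. -/
lemma mul_probState_le (hm : 0 ≤ m) (hp : ∀ i, m ≤ p i) (hδ : 0 ≤ δ) (T : ℕ)
    {P Q : GreedyState → Prop} [DecidablePred P] [DecidablePred Q]
    (h : ∀ s, s.Valid δ → P s → ∃ i, Q (s.step δ (v i))) :
    m * probState p v δ T P ≤ probState p v δ (T + 1) Q := by
  unfold probState
  rw [← expState_mul, expState_succ]
  have hp0 : ∀ i, 0 ≤ p i := fun i => hm.trans (hp i)
  refine expState_mono hp0 hδ T fun s hs => ?_
  have hnn : ∀ i ∈ Finset.univ, 0 ≤ p i * (if Q (s.step δ (v i)) then (1 : ℝ) else 0) :=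
    fun i _ => mul_nonneg (hp0 i) (by split_ifs <;> norm_num)
  by_cases hP : P s
  · obtain ⟨i, hi⟩ := h s hs hP
    refine le_trans ?_ (Finset.single_le_sum hnn (Finset.mem_univ i))
    simpa [hP, hi] using hp i
  · simpa [hP] using Finset.sum_nonneg hnn

end Patterns

/-- The costs `-1, 1, 2` of the lower bound instances, up to scaling. -/
def baseCost : Fin 3 → ℤ := ![-1, 1, 2]

section Base

variable {p : Fin 3 → ℝ} {δ : ℤ} {m : ℝ}

lemma expState_n_succ (hm : 0 ≤ m) (hp : ∀ i, m ≤ p i) (hsum : ∑ i, p i = 1) (hδ : 0 ≤ δ)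
    (T : ℕ) :
    expState p baseCost δ T (fun s => (s.n : ℝ)) +
        m * probState p baseCost δ T (fun s => s.ph = 4) ≤
      expState p baseCost δ (T + 1) (fun s => (s.n : ℝ)) := by
  unfold probState
  rw [← expState_mul, ← expState_add, expState_succ]
  refine expState_mono (fun i => hm.trans (hp i)) hδ T fun s _ => ?_
  rw [Fin.sum_univ_three] at hsum ⊢
  have h1 := hp 1
  by_cases h : s.ph = 4
  · simp [GreedyState.step, baseCost, h]
    linear_combination h1 + (s.n : ℝ) * hsum.symm.le
  · simp [GreedyState.step, baseCost, h]
    linear_combination (s.n : ℝ) * hsum.symm.le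

/-- Whenever the budget is low, a pattern is completed six periods later with probability at
least `m ^ 6`. -/
lemma expState_n_add_six (hm : 0 ≤ m) (hp : ∀ i, m ≤ p i) (hsum : ∑ i, p i = 1) (hδ : 0 ≤ δ)
    (hδ1 : δ ≤ 1) (T : ℕ) :
    expState p baseCost δ (T + 5) (fun s => (s.n : ℝ)) +
        m ^ 6 * probState p baseCost δ T (fun s => s.b ≤ δ + 1) ≤
      expState p baseCost δ (T + 6) (fun s => (s.n : ℝ)) := by
  refine le_trans ?_ (expState_n_succ hm hp hsum hδ (T + 5))
  have h0 : m * probState p baseCost δ T (fun s => s.b ≤ δ + 1) ≤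
      probState p baseCost δ (T + 1) (fun s => s.b = δ) := by
    -- Below `δ` (only `0` when `δ = 1`) a `-1` lifts the budget to `δ`; at `δ` a `1` is rejected;
    -- at `δ + 1` a `1` is accepted and lowers it to `δ`.
    refine mul_probState_le hm hp hδ T fun s hs hb => ?_
    rcases lt_or_ge s.b δ with h | h
    · have := hs.nonneg
      exact ⟨0, by simp [GreedyState.step, baseCost]; split_ifs <;> omega⟩
    · exact ⟨1, by simp [GreedyState.step, baseCost]; split_ifs <;> omega⟩
  have h1 : m * probState p baseCost δ (T + 1) (fun s => s.b = δ) ≤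
      probState p baseCost δ (T + 2) (fun s => s.ph = 1) :=
    mul_probState_le hm hp hδ _ fun s _ hb => ⟨0, by simp [GreedyState.step, baseCost, hb]⟩
  have h2 : m * probState p baseCost δ (T + 2) (fun s => s.ph = 1) ≤
      probState p baseCost δ (T + 3) (fun s => s.ph = 2) :=
    mul_probState_le hm hp hδ _ fun s hs hb =>
      ⟨0, by simp [GreedyState.step, baseCost, hb, hs.one hb]⟩
  have h3 : m * probState p baseCost δ (T + 3) (fun s => s.ph = 2) ≤
      probState p baseCost δ (T + 4) (fun s => s.ph = 3) :=
    mul_probState_le hm hp hδ _ fun s _ hb => ⟨2, by simp [GreedyState.step, baseCost, hb]⟩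
  have h4 : m * probState p baseCost δ (T + 4) (fun s => s.ph = 3) ≤
      probState p baseCost δ (T + 5) (fun s => s.ph = 4) :=
    mul_probState_le hm hp hδ _ fun s _ hb => ⟨1, by simp [GreedyState.step, baseCost, hb]⟩
  have h01 := (mul_le_mul_of_nonneg_left h0 hm).trans h1
  have h02 := (mul_le_mul_of_nonneg_left h01 hm).trans h2
  have h03 := (mul_le_mul_of_nonneg_left h02 hm).trans h3
  have h04 := mul_le_mul_of_nonneg_left ((mul_le_mul_of_nonneg_left h03 hm).trans h4) hm
  linear_combination h04

/-- The six-period bound controls a one-period increment of the expected pattern count, so it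
telescopes without double counting overlapping windows. -/
lemma sum_low_le_expState_n (hm : 0 ≤ m) (hp : ∀ i, m ≤ p i) (hsum : ∑ i, p i = 1)
    (hδ : 0 ≤ δ) (hδ1 : δ ≤ 1) (T : ℕ) :
    m ^ 6 * ∑ t ∈ Finset.range T, probState p baseCost δ t (fun s => s.b ≤ δ + 1) ≤
      expState p baseCost δ (T + 5) (fun s => (s.n : ℝ)) := by
  induction T with
  | zero =>
    simp only [Finset.range_zero, Finset.sum_empty, mul_zero]
    exact Finset.sum_nonneg fun _ _ => mul_nonneg
      (Finset.prod_nonneg fun _ _ => hm.trans (hp _)) (Nat.cast_nonneg _)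
  | succ T ih =>
    rw [Finset.sum_range_succ, mul_add]
    exact (add_le_add_left ih _).trans (expState_n_add_six hm hp hsum hδ hδ1 T)

/-- One-step comparison for a function `f` of the budget: it suffices to check the three lowest
budgets and the budgets at which every arrival is accepted. -/
lemma sum_step_cases (hδ : 0 ≤ δ) (hδ1 : δ ≤ 1) {f : ℤ → ℝ} {C : ℤ → ℤ → ℝ → Prop}
    (hlow : ∀ d b : ℤ, 0 ≤ d → d ≤ 1 → 0 ≤ b → b ≤ d + 1 →
      C d b (p 0 * f (b + 1) + p 1 * f (if 1 + d ≤ b then b - 1 else b) + p 2 * f b))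
    (hhigh : ∀ d b : ℤ, d + 2 ≤ b → 0 ≤ d →
      C d b (p 0 * f (b + 1) + p 1 * f (b - 1) + p 2 * f (b - 2)))
    {s : GreedyState} (hs : s.Valid δ) :
    C δ s.b (∑ i, p i * f (s.step δ (baseCost i)).b) := by
  have h0 := hs.nonneg
  have hneg : -1 + δ ≤ s.b := by omega
  rcases lt_or_ge s.b (δ + 2) with h | h
  · have h2 : ¬ 2 + δ ≤ s.b := by omega
    have := hlow δ s.b hδ hδ1 h0 (by omega)
    by_cases h1 : 1 + δ ≤ s.b <;>
      simpa [Fin.sum_univ_three, GreedyState.step, baseCost, hneg, h1, h2] using this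
  · have h1 : 1 + δ ≤ s.b := by omega
    have h2 : 2 + δ ≤ s.b := by omega
    simpa [Fin.sum_univ_three, GreedyState.step, baseCost, hneg, h1, h2] using hhigh δ s.b h hδ

/-- Comparison of consecutive expectations of functions of the budget. -/
lemma expState_budget_le (hp : ∀ i, 0 ≤ p i) (hδ : 0 ≤ δ) (hδ1 : δ ≤ 1) {f : ℤ → ℝ}
    {h : ℤ → ℤ → ℝ}
    (hlow : ∀ d b : ℤ, 0 ≤ d → d ≤ 1 → 0 ≤ b → b ≤ d + 1 →
      p 0 * f (b + 1) + p 1 * f (if 1 + d ≤ b then b - 1 else b) + p 2 * f b ≤ h d b)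
    (hhigh : ∀ d b : ℤ, d + 2 ≤ b → 0 ≤ d →
      p 0 * f (b + 1) + p 1 * f (b - 1) + p 2 * f (b - 2) ≤ h d b) (T : ℕ) :
    expState p baseCost δ (T + 1) (fun s => f s.b) ≤
      expState p baseCost δ T (fun s => h δ s.b) := by
  rw [expState_succ]
  exact expState_mono hp hδ T fun s hs =>
    sum_step_cases hδ hδ1 (C := fun d b y => y ≤ h d b) hlow hhigh hs

lemma le_expState_budget (hp : ∀ i, 0 ≤ p i) (hδ : 0 ≤ δ) (hδ1 : δ ≤ 1) {f : ℤ → ℝ}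
    {h : ℤ → ℤ → ℝ}
    (hlow : ∀ d b : ℤ, 0 ≤ d → d ≤ 1 → 0 ≤ b → b ≤ d + 1 →
      h d b ≤ p 0 * f (b + 1) + p 1 * f (if 1 + d ≤ b then b - 1 else b) + p 2 * f b)
    (hhigh : ∀ d b : ℤ, d + 2 ≤ b → 0 ≤ d →
      h d b ≤ p 0 * f (b + 1) + p 1 * f (b - 1) + p 2 * f (b - 2)) (T : ℕ) :
    expState p baseCost δ T (fun s => h δ s.b) ≤
      expState p baseCost δ (T + 1) (fun s => f s.b) := by
  rw [expState_succ]
  exact expState_mono hp hδ T fun s hs =>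
    sum_step_cases hδ hδ1 (C := fun d b y => h d b ≤ y) hlow hhigh hs

end Base

/-! ### Drift and moments of the greedy budget. -/

/-- Probabilities for which the three costs `-1, 1, 2` have mean zero. -/
def criticalProb : Fin 3 → ℝ := ![3 / 5, 1 / 5, 1 / 5]

/-- Probabilities for which the three costs `-1, 1, 2` have positive mean. -/
def supercriticalProb : Fin 3 → ℝ := ![1 / 2, 1 / 4, 1 / 4]

lemma criticalProb_ge (i : Fin 3) : 1 / 5 ≤ criticalProb i := by
  fin_cases i <;> norm_num [criticalProb]

lemma supercriticalProb_ge (i : Fin 3) : 1 / 4 ≤ supercriticalProb i := by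
  fin_cases i <;> norm_num [supercriticalProb]

lemma sum_criticalProb : ∑ i, criticalProb i = 1 := by
  simp only [Fin.sum_univ_three, criticalProb, Matrix.cons_val]
  norm_num

lemma sum_supercriticalProb : ∑ i, supercriticalProb i = 1 := by
  simp only [Fin.sum_univ_three, supercriticalProb, Matrix.cons_val]
  norm_num

section Moments

lemma criticalProb_nonneg (i : Fin 3) : 0 ≤ criticalProb i :=
  le_trans (by norm_num) (criticalProb_ge i)

lemma supercriticalProb_nonneg (i : Fin 3) : 0 ≤ supercriticalProb i :=
  le_trans (by norm_num) (supercriticalProb_ge i)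

variable {δ : ℤ}

/-- The budget has zero drift where every arrival is affordable, and drift at most `3 / 5`, hence at
most one, at low budgets. -/
lemma critical_first_moment (hδ : 0 ≤ δ) (hδ1 : δ ≤ 1) (T : ℕ) :
    expState criticalProb baseCost δ T (fun s => (s.b : ℝ)) ≤
      ∑ t ∈ Finset.range T, probState criticalProb baseCost δ t (fun s => s.b ≤ δ + 1) := by
  induction T with
  | zero => simp [expState_zero]
  | succ T ih =>
    rw [Finset.sum_range_succ]
    refine le_trans ?_ (add_le_add_left ih _)
    unfold probState
    rw [← expState_add]
    refine expState_budget_le criticalProb_nonneg hδ hδ1 (f := fun b => (b : ℝ))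
      (h := fun d b => (b : ℝ) + if b ≤ d + 1 then 1 else 0) ?_ ?_ T
    · intro d b _ _ _ hb
      simp only [criticalProb, hb, if_true, Matrix.cons_val]
      split_ifs <;> push_cast <;> linarith
    · intro d b hb _
      simp only [criticalProb, Matrix.cons_val]
      split_ifs <;> push_cast <;> linarith

/-- The drift is `-1 / 4` where every arrival is affordable and at most `1 / 2 ≤ 1 - 1 / 4`
elsewhere; a nonnegative budget forces enough low visits to compensate. -/
lemma supercritical_first_moment (hδ : 0 ≤ δ) (hδ1 : δ ≤ 1) (T : ℕ) :
    (T : ℝ) / 4 ≤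
      ∑ t ∈ Finset.range T, probState supercriticalProb baseCost δ t (fun s => s.b ≤ δ + 1) := by
  have key : ∀ T : ℕ, expState supercriticalProb baseCost δ T (fun s => (s.b : ℝ)) + (T : ℝ) / 4 ≤
      ∑ t ∈ Finset.range T, probState supercriticalProb baseCost δ t (fun s => s.b ≤ δ + 1) := by
    intro T
    induction T with
    | zero => simp [expState_zero]
    | succ T ih =>
      rw [Finset.sum_range_succ]
      have hstep : expState supercriticalProb baseCost δ (T + 1) (fun s => (s.b : ℝ)) ≤
          expState supercriticalProb baseCost δ T (fun s => (s.b : ℝ)) +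
            (probState supercriticalProb baseCost δ T (fun s => s.b ≤ δ + 1) + -1 / 4) := by
        unfold probState
        rw [← expState_const (p := supercriticalProb) (v := baseCost) (δ := δ)
          sum_supercriticalProb (-1 / 4) T, ← expState_add, ← expState_add]
        refine expState_budget_le supercriticalProb_nonneg hδ hδ1 (f := fun b => (b : ℝ))
          (h := fun d b => (b : ℝ) + ((if b ≤ d + 1 then 1 else 0) + -1 / 4)) ?_ ?_ T
        · intro d b _ _ _ hb
          simp only [supercriticalProb, hb, if_true, Matrix.cons_val]
          split_ifs <;> push_cast <;> linarith
        · intro d b hb _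
          simp only [supercriticalProb, Matrix.cons_val]
          split_ifs <;> push_cast <;> linarith
      push_cast
      linarith
  refine le_trans ?_ (key T)
  refine le_add_of_nonneg_left (le_of_eq_of_le ?_ (expState_mono supercriticalProb_nonneg hδ T
    (F := fun _ => 0) (G := fun s => (s.b : ℝ)) fun s hs => by exact_mod_cast hs.nonneg))
  rw [expState_const sum_supercriticalProb]

/-- The expected square grows by the step variance `8 / 5` at high budgets; the least growth, `3 /
5`, occurs at budget zero, where only a `-1` changes anything. -/
lemma critical_second_moment_ge (hδ : 0 ≤ δ) (hδ1 : δ ≤ 1) (T : ℕ) :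
    3 / 5 * (T : ℝ) ≤ expState criticalProb baseCost δ T (fun s => (s.b : ℝ) ^ 2) := by
  induction T with
  | zero => simp [expState_zero]
  | succ T ih =>
    have : expState criticalProb baseCost δ T (fun s => (s.b : ℝ) ^ 2) + 3 / 5 ≤
        expState criticalProb baseCost δ (T + 1) (fun s => (s.b : ℝ) ^ 2) := by
      rw [← expState_const (p := criticalProb) (v := baseCost) (δ := δ)
        sum_criticalProb (3 / 5) T, ← expState_add]
      refine le_expState_budget criticalProb_nonneg hδ hδ1 (f := fun b => (b : ℝ) ^ 2)
        (h := fun _ b => (b : ℝ) ^ 2 + 3 / 5) ?_ ?_ T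
      · intro d b hd hd1 hb0 hb
        have hb2 : b ≤ 2 := by omega
        simp only [criticalProb, Matrix.cons_val]
        interval_cases d <;> interval_cases b <;> norm_num at *
      · intro d b hb _
        simp only [criticalProb, Matrix.cons_val]
        push_cast; linarith
    push_cast
    linarith

lemma critical_second_moment_le (hδ : 0 ≤ δ) (hδ1 : δ ≤ 1) (T : ℕ) :
    expState criticalProb baseCost δ T (fun s => (s.b : ℝ) ^ 2) ≤ 3 * (T : ℝ) := by
  induction T with
  | zero => simp [expState_zero]
  | succ T ih =>
    have : expState criticalProb baseCost δ (T + 1) (fun s => (s.b : ℝ) ^ 2) ≤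
        expState criticalProb baseCost δ T (fun s => (s.b : ℝ) ^ 2) + 3 := by
      rw [← expState_const (p := criticalProb) (v := baseCost) (δ := δ)
        sum_criticalProb 3 T, ← expState_add]
      refine expState_budget_le criticalProb_nonneg hδ hδ1 (f := fun b => (b : ℝ) ^ 2)
        (h := fun _ b => (b : ℝ) ^ 2 + 3) ?_ ?_ T
      · intro d b hd hd1 hb0 hb
        have hb2 : b ≤ 2 := by omega
        simp only [criticalProb, Matrix.cons_val]
        interval_cases d <;> interval_cases b <;> norm_num at *
      · intro d b hb _
        simp only [criticalProb, Matrix.cons_val]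
        push_cast; linarith
    push_cast
    linarith

/-- At high budgets the mean-zero step cancels the cubic term, leaving growth `48 / 5 * b ^ 2 - 24 /
5 * b + 4`; the second moment bound then makes the sum quadratic in `T`. -/
lemma critical_fourth_moment_le (hδ : 0 ≤ δ) (hδ1 : δ ≤ 1) (T : ℕ) :
    expState criticalProb baseCost δ T (fun s => (s.b : ℝ) ^ 4) ≤ 55 * (T : ℝ) ^ 2 := by
  induction T with
  | zero => simp [expState_zero]
  | succ T ih =>
    have : expState criticalProb baseCost δ (T + 1) (fun s => (s.b : ℝ) ^ 4) ≤
        expState criticalProb baseCost δ T (fun s => (s.b : ℝ) ^ 4) +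
          (10 * expState criticalProb baseCost δ T (fun s => (s.b : ℝ) ^ 2) + 40) := by
      rw [← expState_mul, ← expState_const (p := criticalProb) (v := baseCost) (δ := δ)
        sum_criticalProb 40 T, ← expState_add, ← expState_add]
      refine expState_budget_le criticalProb_nonneg hδ hδ1 (f := fun b => (b : ℝ) ^ 4)
        (h := fun _ b => (b : ℝ) ^ 4 + (10 * (b : ℝ) ^ 2 + 40)) ?_ ?_ T
      · intro d b hd hd1 hb0 hb
        have hb2 : b ≤ 2 := by omega
        simp only [criticalProb, Matrix.cons_val]
        interval_cases d <;> interval_cases b <;> norm_num at *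
      · intro d b hb hd
        have hb0 : (0 : ℝ) ≤ b := by exact_mod_cast (by omega : 0 ≤ b)
        simp only [criticalProb, Matrix.cons_val]
        push_cast; nlinarith [sq_nonneg (b : ℝ)]
    have h2 := critical_second_moment_le hδ hδ1 T
    push_cast
    nlinarith [(Nat.cast_nonneg T : (0 : ℝ) ≤ T)]

/-- The expected budget is of order `√T`, by comparison of its second and fourth moments. -/
lemma critical_first_moment_ge (hδ : 0 ≤ δ) (hδ1 : δ ≤ 1) (T : ℕ) :
    1 / 50 * Real.sqrt T ≤ expState criticalProb baseCost δ T (fun s => (s.b : ℝ)) := by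
  rcases Nat.eq_zero_or_pos T with rfl | hT
  · simp [expState_zero]
  have hr : 0 < Real.sqrt T := Real.sqrt_pos.2 (by exact_mod_cast hT)
  have hrT : Real.sqrt T ^ 2 = T := Real.sq_sqrt (Nat.cast_nonneg T)
  set r := Real.sqrt T
  -- Pointwise, `u ^ 2 - u ^ 4 ≤ u` for `u = b / (20 r) ≥ 0`. The scale 20 leaves `3 / 100 - 55 /
  -- 8000`, which exceeds `1 / 50`.
  have hle : expState criticalProb baseCost δ T
      (fun s => 1 / (20 * r) * (s.b : ℝ) ^ 2 + -(1 / (20 * r) ^ 3) * (s.b : ℝ) ^ 4) ≤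
        expState criticalProb baseCost δ T (fun s => (s.b : ℝ)) := by
    refine expState_mono criticalProb_nonneg hδ T fun s hs => ?_
    have hb : (0 : ℝ) ≤ s.b := by exact_mod_cast hs.nonneg
    set u : ℝ := s.b / (20 * r) with hu
    have hbu : (s.b : ℝ) = 20 * r * u := by rw [hu]; field_simp
    have hu0 : 0 ≤ u := by positivity
    have e : 1 / (20 * r) * (s.b : ℝ) ^ 2 + -(1 / (20 * r) ^ 3) * (s.b : ℝ) ^ 4 =
        20 * r * (u ^ 2 - u ^ 4) := by
      rw [hbu]; field_simp; ring
    rw [e, hbu]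
    refine mul_le_mul_of_nonneg_left ?_ (by positivity)
    rcases le_total u 1 with h | h
    · nlinarith [pow_nonneg hu0 4]
    · nlinarith [pow_nonneg hu0 2, mul_nonneg (pow_nonneg hu0 2) (by nlinarith : 0 ≤ u ^ 2 - 1)]
  rw [expState_add, expState_mul, expState_mul] at hle
  refine le_trans ?_ hle
  have h2 := mul_le_mul_of_nonneg_left (critical_second_moment_ge hδ hδ1 T)
    (by positivity : 0 ≤ 1 / (20 * r))
  have h4 := mul_le_mul_of_nonneg_left (critical_fourth_moment_le hδ hδ1 T)
    (by positivity : 0 ≤ 1 / (20 * r) ^ 3)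
  rw [← hrT] at h2 h4
  have e2 : 1 / (20 * r) * (3 / 5 * r ^ 2) = 3 / 100 * r := by field_simp; ring
  have e4 : 1 / (20 * r) ^ 3 * (55 * (r ^ 2) ^ 2) = 55 / 8000 * r := by field_simp; ring
  rw [e2] at h2
  rw [e4] at h4
  linarith

end Moments

end CostDist

/-! ### The linear programs of the two instances and the final bounds. -/

lemma lastResolve_le {T : ℕ} (R : Finset (Fin T)) (t : Fin T) : lastResolve R t ≤ t := by
  unfold lastResolve
  split_ifs with h
  · exact (Finset.mem_filter.1 (Finset.max'_mem _ h)).2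
  · exact le_rfl

namespace CostDist

variable {α : ℝ}

/-- A re-solving heuristic whose acceptance probabilities are all one is greedy. -/
lemma reducesToGreedy_resolve (D : CostDist α) {T : ℕ} (strict : Bool) (R : Finset (Fin T))
    {g : Fin T → Fin D.k → ℝ → ℝ} {x : ℝ → Fin D.k → ℝ}
    (h : ∀ b, 0 ≤ b → ∀ s i, g s i (x b i) = 1) :
    D.ReducesToGreedy strict (D.resolve T strict R g x) := by
  intro t ω X hB
  simp only [resolve, greedy]
  rw [h]
  have : ((lastResolve R t : ℕ) : ℝ) ≤ T := by exact_mod_cast (lastResolve R t).is_lt.le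
  exact div_nonneg (hB _ (lastResolve_le R t)) (sub_nonneg.2 this)

/-- The distribution of the costs `-1, 1, 2`, scaled into `[-α, 1 - α]`. -/
def scaledBase (h0 : 0 < α) (h1 : α < 1) (p : Fin 3 → ℝ) (hp : ∀ i, 0 < p i)
    (hsum : ∑ i, p i = 1) : CostDist α where
  k := 3
  a i := α * (1 - α) / 2 * baseCost i
  p := p
  a_strictMono := by
    have hε : 0 < α * (1 - α) / 2 := by nlinarith
    have hb : StrictMono baseCost := by
      intro i j hij
      fin_cases i <;> fin_cases j <;> simp_all [baseCost]
    exact fun i j hij => mul_lt_mul_of_pos_left (by exact_mod_cast hb hij) hε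
  a_mem i := by
    have h : 0 < 1 - α := by linarith
    fin_cases i <;> simp [baseCost] <;> constructor <;> nlinarith
  exists_nonpos := ⟨0, by simp [baseCost]; nlinarith⟩
  exists_pos := ⟨1, by simp [baseCost]; nlinarith⟩
  p_pos := hp
  p_sum := hsum

/-- Mean zero costs `-1, 1, 2`, scaled. -/
def critical (h0 : 0 < α) (h1 : α < 1) : CostDist α :=
  scaledBase h0 h1 criticalProb (fun i => lt_of_lt_of_le (by norm_num) (criticalProb_ge i))
    sum_criticalProb

/-- Costs `-1, 1, 2` of positive mean, scaled. -/
def supercritical (h0 : 0 < α) (h1 : α < 1) : CostDist α :=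
  scaledBase h0 h1 supercriticalProb
    (fun i => lt_of_lt_of_le (by norm_num) (supercriticalProb_ge i)) sum_supercriticalProb

section Instances

variable (h0 : 0 < α) (h1 : α < 1)

lemma critical_degenerate : (critical h0 h1).Degenerate := by
  have hε : 0 < α * (1 - α) / 2 := by nlinarith
  refine ⟨(2 : Fin 3), ?_, ?_⟩
  · change 0 < α * (1 - α) / 2 * (baseCost 2 : ℝ)
    simpa [baseCost] using hε
  · change ∑ j ∈ Finset.univ.filter (fun j : Fin 3 => j ≤ 2),
      criticalProb j * (α * (1 - α) / 2 * (baseCost j : ℝ)) = 0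
    have : (Finset.univ.filter fun j : Fin 3 => j ≤ 2) = Finset.univ := by decide
    rw [this, Fin.sum_univ_three]
    simp only [criticalProb, baseCost, Matrix.cons_val]
    push_cast; ring

/-- In the critical instance the only optimal solution accepts everything. -/
lemma critical_solution {x : ℝ → Fin 3 → ℝ} (hx : (critical h0 h1).IsDLPSolver x) {b : ℝ}
    (hb : 0 ≤ b) (i : Fin 3) : x b i = 1 := by
  obtain ⟨⟨hbd, -⟩, hmax⟩ := hx b hb
  -- Accepting everything has expected cost zero, hence is feasible for every `b ≥ 0`; comparison
  -- with it forces each coordinate up to one.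
  have hones : (fun _ => 1) ∈ (critical h0 h1).dlpFeasible b := by
    refine ⟨fun _ => ⟨zero_le_one, le_rfl⟩, ?_⟩
    change ∑ i : Fin 3, α * (1 - α) / 2 * (baseCost i : ℝ) * criticalProb i * 1 ≤ b
    rw [Fin.sum_univ_three]
    simp only [criticalProb, baseCost, Matrix.cons_val]
    push_cast; linarith
  have h : ∑ i : Fin 3, criticalProb i * 1 ≤ ∑ i : Fin 3, criticalProb i * x b i := hmax hones
  have hle : ∀ i : Fin 3, x b i ≤ 1 := fun i => (hbd i).2
  have hle0 := hle 0
  have hle1 := hle 1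
  have hle2 := hle 2
  simp only [Fin.sum_univ_three, criticalProb, Matrix.cons_val] at h
  refine le_antisymm (hle i) ?_
  fin_cases i <;> simp only [Fin.zero_eta, Fin.mk_one, Fin.reduceFinMk] <;> linarith

/-- In the supercritical instance optimal solutions accept every type with probability at least
one half. -/
lemma supercritical_solution {x : ℝ → Fin 3 → ℝ} (hx : (supercritical h0 h1).IsDLPSolver x)
    {b : ℝ} (hb : 0 ≤ b) (i : Fin 3) : 1 / 2 ≤ x b i := by
  obtain ⟨⟨hbd, -⟩, hmax⟩ := hx b hb
  -- This point has expected cost zero and value `7 / 8`. An optimal solution thus loses at most `1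
  -- / 8` in total, and every type has probability at least `1 / 4`, so no coordinate falls below `1
  -- / 2`.
  have hfeas : (![1, 1, 1 / 2] : Fin 3 → ℝ) ∈ (supercritical h0 h1).dlpFeasible b := by
    refine ⟨fun (j : Fin 3) => ?_, ?_⟩
    · fin_cases j <;> norm_num
    change ∑ i : Fin 3, α * (1 - α) / 2 * (baseCost i : ℝ) * supercriticalProb i *
      (![1, 1, 1 / 2] : Fin 3 → ℝ) i ≤ b
    rw [Fin.sum_univ_three]
    simp only [supercriticalProb, baseCost, Matrix.cons_val]
    push_cast; linarith
  have h : ∑ i : Fin 3, supercriticalProb i * (![1, 1, 1 / 2] : Fin 3 → ℝ) i ≤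
      ∑ i : Fin 3, supercriticalProb i * x b i := hmax hfeas
  have hle : ∀ i : Fin 3, x b i ≤ 1 := fun i => (hbd i).2
  have hle0 := hle 0
  have hle1 := hle 1
  have hle2 := hle 2
  simp only [Fin.sum_univ_three, supercriticalProb, Matrix.cons_val] at h
  fin_cases i <;> simp only [Fin.zero_eta, Fin.mk_one, Fin.reduceFinMk] <;> linarith

lemma critical_reducesToGreedy {T : ℕ} (strict : Bool) {R : Finset (Fin T)}
    {g : Fin T → Fin 3 → ℝ → ℝ} {x : ℝ → Fin 3 → ℝ} (hg : ∀ s i, g s i 1 = 1)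
    (hx : (critical h0 h1).IsDLPSolver x) :
    (critical h0 h1).ReducesToGreedy strict ((critical h0 h1).resolve T strict R g x) :=
  reducesToGreedy_resolve _ strict R fun b hb s i =>
    (congrArg (g s i) (critical_solution h0 h1 hx hb i)).trans (hg s i)

lemma critical_gap {T : ℕ} (hT : 10 ≤ T) {strict : Bool} {π : (critical h0 h1).Policy T}
    (hπ : (critical h0 h1).ReducesToGreedy strict π) :
    (1 / 5) ^ 6 / 100 * Real.sqrt T ≤
      (critical h0 h1).expHOany T - (critical h0 h1).expReward π := by
  have hε : 0 < α * (1 - α) / 2 := by nlinarith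
  have hs := shift_nonneg strict
  have hs1 := shift_le_one strict
  refine le_trans ?_ ((critical h0 h1).expState_n_le hε (v := baseCost) (fun _ => rfl) hπ)
  -- The pattern count lags the low visits by five periods; for `N ≥ 5` this costs at most a factor
  -- two in `√T`.
  obtain ⟨N, rfl⟩ : ∃ N, T = N + 5 := ⟨T - 5, by omega⟩
  refine le_trans ?_ (sum_low_le_expState_n (by norm_num) criticalProb_ge sum_criticalProb
    hs hs1 N)
  have hsum := (critical_first_moment_ge hs hs1 N).trans (critical_first_moment hs hs1 N)
  have hN : Real.sqrt ((N + 5 : ℕ) : ℝ) ≤ 2 * Real.sqrt N := by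
    rw [Real.sqrt_le_left (by positivity), mul_pow, Real.sq_sqrt (Nat.cast_nonneg N)]
    have : (5 : ℝ) ≤ N := by exact_mod_cast (by omega : 5 ≤ N)
    push_cast; linarith
  have := mul_le_mul_of_nonneg_left hsum (by norm_num : (0 : ℝ) ≤ (1 / 5) ^ 6)
  refine le_trans ?_ this
  linarith

lemma supercritical_gap {T : ℕ} (hT : 10 ≤ T) {strict : Bool}
    {π : (supercritical h0 h1).Policy T}
    (hπ : (supercritical h0 h1).ReducesToGreedy strict π) :
    (1 / 4) ^ 6 / 8 * (T : ℝ) ≤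
      (supercritical h0 h1).expHOany T - (supercritical h0 h1).expReward π := by
  have hε : 0 < α * (1 - α) / 2 := by nlinarith
  have hs := shift_nonneg strict
  have hs1 := shift_le_one strict
  refine le_trans ?_ ((supercritical h0 h1).expState_n_le hε (v := baseCost) (fun _ => rfl) hπ)
  obtain ⟨N, rfl⟩ : ∃ N, T = N + 5 := ⟨T - 5, by omega⟩
  refine le_trans ?_ (sum_low_le_expState_n (by norm_num) supercriticalProb_ge
    sum_supercriticalProb hs hs1 N)
  have := mul_le_mul_of_nonneg_left (supercritical_first_moment hs hs1 N)
    (by norm_num : (0 : ℝ) ≤ (1 / 4) ^ 6)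
  refine le_trans ?_ this
  -- From `N ≥ 5` follows `N ≥ (N + 5) / 2`, which turns the rate `1 / 4` into `1 / 8`.
  have : (5 : ℝ) ≤ N := by exact_mod_cast (by omega : 5 ≤ N)
  push_cast; linarith

end Instances

end CostDist

end

theorem proposition3 (α : ℝ) (hα0 : 0 < α) (hα1 : α < 1) :
    (∃ D : CostDist α, D.Degenerate ∧
      (∀ (T : ℕ) (strict : Bool) (R : Finset (Fin T)) (g : Fin T → Fin D.k → ℝ → ℝ)
        (x : ℝ → Fin D.k → ℝ),
        (∀ t, ∃ s ∈ R, s ≤ t) → (∀ s i, IsTruncation (g s i)) → D.IsDLPSolver x →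
        D.ReducesToGreedy strict (D.FR T strict x) ∧
        D.ReducesToGreedy strict (D.IFR T strict R g x) ∧
        D.ReducesToGreedy strict (D.FRT T strict g x) ∧
        D.ReducesToGreedy strict (D.Bayes T strict x)) ∧
      ∃ c : ℝ, 0 < c ∧ ∃ T₀ : ℕ, ∀ T : ℕ, T₀ ≤ T →
        ∀ (strict : Bool) (R : Finset (Fin T)) (g : Fin T → Fin D.k → ℝ → ℝ)
          (x : ℝ → Fin D.k → ℝ),
        (∀ t, ∃ s ∈ R, s ≤ t) → (∀ s i, IsTruncation (g s i)) → D.IsDLPSolver x →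
        c * Real.sqrt T ≤ D.expHOany T -
          max (max (D.expReward (D.FR T strict x)) (D.expReward (D.IFR T strict R g x)))
            (max (D.expReward (D.FRT T strict g x)) (D.expReward (D.Bayes T strict x)))) ∧
    (∃ D : CostDist α, ∃ c : ℝ, 0 < c ∧ ∃ T₀ : ℕ, ∀ T : ℕ, T₀ ≤ T →
      ∀ (strict : Bool) (x : ℝ → Fin D.k → ℝ), D.IsDLPSolver x →
        c * (T : ℝ) ≤ D.expHOany T - D.expReward (D.Bayes T strict x)) := by
  classical
  refine ⟨⟨CostDist.critical hα0 hα1, CostDist.critical_degenerate hα0 hα1, ?_,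
    (1 / 5) ^ 6 / 100, by norm_num, 10, ?_⟩,
    CostDist.supercritical hα0 hα1, (1 / 4) ^ 6 / 8, by norm_num, 10, ?_⟩
  · intro T strict R g x _ hg hx
    exact ⟨CostDist.critical_reducesToGreedy hα0 hα1 strict (fun _ _ => rfl) hx,
      CostDist.critical_reducesToGreedy hα0 hα1 strict (fun s i => (hg s i).2.1) hx,
      CostDist.critical_reducesToGreedy hα0 hα1 strict (fun s i => (hg s i).2.1) hx,
      CostDist.critical_reducesToGreedy hα0 hα1 strict (fun _ _ => if_pos (by norm_num)) hx⟩
  · intro T hT strict R g x _ hg hx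
    rw [le_sub_comm]
    refine max_le (max_le ?_ ?_) (max_le ?_ ?_) <;> rw [le_sub_comm] <;>
      refine CostDist.critical_gap hα0 hα1 hT (strict := strict) ?_
    · exact CostDist.critical_reducesToGreedy hα0 hα1 strict (fun _ _ => rfl) hx
    · exact CostDist.critical_reducesToGreedy hα0 hα1 strict (fun s i => (hg s i).2.1) hx
    · exact CostDist.critical_reducesToGreedy hα0 hα1 strict (fun s i => (hg s i).2.1) hx
    · exact CostDist.critical_reducesToGreedy hα0 hα1 strict
        (fun _ _ => if_pos (by norm_num)) hx
  · intro T hT strict x hx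
    refine CostDist.supercritical_gap hα0 hα1 hT (strict := strict) ?_
    exact CostDist.reducesToGreedy_resolve _ strict _ fun _ hb _ i =>
      if_pos (CostDist.supercritical_solution hα0 hα1 hx hb i)
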